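/- Let $H=(V,E)$ be a connected hypergraph: $V$ is a finite set, $E$ is a set of nonempty subsets of $V$ (hyperedges), and any two distinct vertices $v,w$ are joined by hyperedges $e_1,\dots,e_m$ with $v\in e_1$, $w\in e_m$ and $e_i\cap e_{i+1}\neq\emptyset$. Let $q\in V$ be a root, and let $B(H)$ be the bipartite incidence graph with left vertices $E$, right vertices $V$, and an edge $\{e,v\}$ whenever $v\in e$. An *$H$-parking function* is a function $c:V\setminus\{q\}\to\mathbb{Z}_{\ge 0}$ such that every nonempty $T\subseteq V\setminus\{q\}$ contains some $i$ with $c_i<|\{e\in E: i\in e,\ e\not\subseteq T\}|$. Two spanning trees of $B(H)$ are *burning equivalent* if, when all their edges are oriented towards $q$, they have the same set of edges directed from $V$ to $E$. A *$q$-rooted spanning tree of $H$* is a burning equivalence class $[T]$ of spanning trees $T$ of $B(H)$. Fix any total order $\beta$ on the vertices of $B(H)$. For a subtree $t$ of $B(H)$ containing $q$, order the vertices of $t$ by their distance to $q$ in $t$, breaking ties by $\beta$. For an $H$-parking function $c$ put $b_v=c_v$ for $v\in V\setminus\{q\}$ and $b_e=0$ for $e\in E$. Start with the tree $t_0=\{q\}$.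 Given $t_{m-1}$, let $V_m$ be the set of vertices $j$ of $B(H)$ outside $t_{m-1}$ with at least $b_j+1$ neighbours in $t_{m-1}$; for $j\in V_m$ let $e_j$ be the edge from $j$ to the neighbour in $t_{m-1}$ that has exactly $b_j$ neighbours of $j$ in $t_{m-1}$ before it in the order of $t_{m-1}$; let $t$ be $t_{m-1}$ together with all $j\in V_m$ and their edges $e_j$; let $p_m$ be the smallest element of $V_m$ in the order of $t$; and let $t_m$ be $t_{m-1}$ together with $p_m$ and $e_{p_m}$. Stop at $m=|V|+|E|-1$ and call the result $T_c$. (This is the breadth-first Chebikin–Pylyavskyy burning algorithm on $B(H)$.) **Theorem.** For every $H$-parking function $c$, the graph $T_c$ is a spanning tree of $B(H)$, and the map $c\mapsto[T_c]$ is a bijection from the set of $H$-parking functions to the set of $q$-rooted spanning trees of $H$. -/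

import Mathlib

/-! ### Breadth-first burning on a graph with a sink -/

namespace Burning

variable {W : Type*} {G : SimpleGraph W}

/-- The height of `v` in a subtree `t` rooted at `q`: the number of edges of the path in `t` between
`v` and `q`. (Only used for vertices of a tree `t` containing `q`.) -/
noncomputable def height (q : W) (t : G.Subgraph) (v : W) : ℕ :=
  t.spanningCoe.dist v q

/-- The breadth-first tree order: compare heights first and break ties with the total order `β`. -/
def treeLt (q : W) (β : LinearOrder W) (t : G.Subgraph) (i j : W) : Prop :=
  height q t i < height q t j ∨ (height q t i = height q t j ∧ β.lt i j)

/-- The neighbours of `j` in `G` which are vertices of `t`, that is, the edges from `j` to `t`. -/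
def nbrsIn (t : G.Subgraph) (j : W) : Set W :=
  {i | G.Adj j i ∧ i ∈ t.verts}

/-- The vertices outside `t` which have at least `b j + 1` edges to `t`. -/
def ready (b : W → ℕ) (t : G.Subgraph) : Set W :=
  {j | j ∉ t.verts ∧ b j + 1 ≤ (nbrsIn t j).ncard}

/-- The edge from `j` to `i` is the edge from `j` to `t` which has exactly `b j` edges from `j` to
`t` below it in the breadth-first order. -/
def IsBurningEdge (q : W) (β : LinearOrder W) (b : W → ℕ) (t : G.Subgraph) (j i : W) : Prop :=
  i ∈ nbrsIn t j ∧ {i' | i' ∈ nbrsIn t j ∧ treeLt q β t i' i}.ncard = b j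

/-- The tree `t` with every vertex `j ∈ A` adjoined along its burning edge, where `A` is a set of
vertices that are ready. -/
def adjoin (q : W) (β : LinearOrder W) (b : W → ℕ) (t : G.Subgraph) (A : Set W) : G.Subgraph where
  verts := t.verts ∪ A
  Adj x y := t.Adj x y ∨ (x ∈ A ∧ IsBurningEdge q β b t x y) ∨ (y ∈ A ∧ IsBurningEdge q β b t y x)
  adj_sub := by
    rintro x y (h | ⟨-, h, -⟩ | ⟨-, h, -⟩)
    · exact t.adj_sub h
    · exact h.1
    · exact h.1.symm
  edge_vert := by
    rintro x y (h | ⟨h, -⟩ | ⟨-, h, -⟩)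
    · exact Or.inl (t.edge_vert h)
    · exact Or.inr h
    · exact Or.inl h.2
  symm := ⟨by
    rintro x y (h | h | h)
    · exact Or.inl h.symm
    · exact Or.inr (Or.inr h)
    · exact Or.inr (Or.inl h)⟩

/-- The smallest ready vertex, as a set with at most one element: adjoin all ready vertices to `t`,
and take the smallest of them in the breadth-first order of the resulting tree. -/
def nextVertex (q : W) (β : LinearOrder W) (b : W → ℕ) (t : G.Subgraph) : Set W :=
  {p | p ∈ ready b t ∧ ∀ j ∈ ready b t, ¬ treeLt q β (adjoin q β b t (ready b t)) j p}

/-- One step of the algorithm: adjoin the smallest ready vertex along its burning edge (if there is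
no ready vertex, nothing changes). -/
def step (q : W) (β : LinearOrder W) (b : W → ℕ) (t : G.Subgraph) : G.Subgraph :=
  adjoin q β b t (nextVertex q β b t)

variable (G) in
/-- The output of the breadth-first Chebikin-Pylyavskyy burning algorithm for the graph `G` with
sink `q`, the total order `β` on its vertices and the chips `b`: start with the tree `{q}` and make
`n` steps, where `n` is the number of nonsink vertices. The value `b q` plays no role. -/
noncomputable def burningTree (q : W) (β : LinearOrder W) (b : W → ℕ) : SimpleGraph W :=
  ((step q β b)^[Nat.card W - 1] (G.singletonSubgraph q)).spanningCoe

end Burning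

/-! ### Spanning trees and burning equivalence -/

/-- `T` is a spanning tree of `G`. -/
def IsSpanningTree {W : Type*} (G T : SimpleGraph W) : Prop :=
  T ≤ G ∧ T.IsTree

/-- `x → y` is an edge of the tree `T` when all its edges are oriented towards `q`. -/
def DirectedEdge {W : Type*} (q : W) (T : SimpleGraph W) (x y : W) : Prop :=
  T.Adj x y ∧ T.dist y q < T.dist x q

/-- The set of edges of `T` directed from the right part to the left part when all edges of `T` are
oriented towards the sink `q`. -/
def rightToLeft {L R : Type*} (q : R) (T : SimpleGraph (L ⊕ R)) : Set (R × L) :=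
  {p | DirectedEdge (Sum.inr q) T (Sum.inr p.1) (Sum.inl p.2)}

/-- Burning equivalence of spanning trees of a bipartite graph `B` with sink `q` on the right. -/
def burningSetoid {L R : Type*} (B : SimpleGraph (L ⊕ R)) (q : R) :
    Setoid {T : SimpleGraph (L ⊕ R) // IsSpanningTree B T} where
  r T T' := rightToLeft q T.1 = rightToLeft q T'.1
  iseqv := ⟨fun _ => rfl, Eq.symm, Eq.trans⟩

/-! ### Hypergraphs -/

namespace Hypergraph

variable {α : Type*}

/-- Any two distinct vertices are joined by a sequence of hyperedges, consecutive ones having a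
common vertex. -/
def IsConnected (H : Hypergraph α) : Prop :=
  ∀ v ∈ H.vertexSet, ∀ w ∈ H.vertexSet, v ≠ w →
    ∃ e ∈ H.edgeSet, ∃ f ∈ H.edgeSet, v ∈ e ∧ w ∈ f ∧ Relation.ReflTransGen H.EAdj e f

/-- The bipartite incidence graph `B(H)`: hyperedges on the left, vertices on the right. -/
def incidenceGraph (H : Hypergraph α) : SimpleGraph (H.edgeSet ⊕ H.vertexSet) where
  Adj
    | Sum.inl e, Sum.inr v => v.1 ∈ e.1
    | Sum.inr v, Sum.inl e => v.1 ∈ e.1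
    | _, _ => False
  symm := ⟨by rintro (_ | _) (_ | _) h <;> exact h⟩
  loopless := ⟨by rintro (_ | _) h <;> exact h⟩

/-- The `T`-degree of `v`: the number of hyperedges that contain `v` and are not contained
in `T`. -/
noncomputable def relDegree (H : Hypergraph α) (T : Set H.vertexSet) (v : H.vertexSet) : ℕ :=
  {e : Set α | e ∈ H.edgeSet ∧ v.1 ∈ e ∧ ¬ e ⊆ Subtype.val '' T}.ncard

/-- `c`, a configuration on the nonsink vertices, is an `H`-parking function: every nonempty set `T`
of nonsink vertices contains some `i` with `c i < deg_T i`. -/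
def IsParkingFunction (H : Hypergraph α) (q : H.vertexSet) (c : {v : H.vertexSet // v ≠ q} → ℕ) :
    Prop :=
  ∀ T : Set {v : H.vertexSet // v ≠ q}, T.Nonempty →
    ∃ i ∈ T, c i < H.relDegree (Subtype.val '' T) i.1

/-- A `q`-rooted spanning tree of `H`: a burning equivalence class of spanning trees of `B(H)`. -/
def RootedSpanningTree (H : Hypergraph α) (q : H.vertexSet) : Type _ :=
  Quotient (burningSetoid H.incidenceGraph q)

/-- The class of a spanning tree of `B(H)`. -/
def RootedSpanningTree.mk (H : Hypergraph α) (q : H.vertexSet)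
    (T : {T : SimpleGraph (H.edgeSet ⊕ H.vertexSet) // IsSpanningTree H.incidenceGraph T}) :
    H.RootedSpanningTree q :=
  Quotient.mk (burningSetoid H.incidenceGraph q) T

open Classical in
/-- The configuration on `B(H)` with the same chips as `c` on the nonsink vertices of `H` and no
chips on the hyperedges. (The entry at the sink is a placeholder.) -/
noncomputable def liftConfig (H : Hypergraph α) (q : H.vertexSet)
    (c : {v : H.vertexSet // v ≠ q} → ℕ) : H.edgeSet ⊕ H.vertexSet → ℕ
  | Sum.inl _ => 0
  | Sum.inr v => if h : v ≠ q then c ⟨v, h⟩ else 0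

/-- The tree in `B(H)` which the burning algorithm produces from the configuration `c`. -/
noncomputable def burningTree (H : Hypergraph α) (q : H.vertexSet)
    (β : LinearOrder (H.edgeSet ⊕ H.vertexSet)) (c : {v : H.vertexSet // v ≠ q} → ℕ) :
    SimpleGraph (H.edgeSet ⊕ H.vertexSet) :=
  Burning.burningTree H.incidenceGraph (Sum.inr q) β (H.liftConfig q c)

end Hypergraph

/-! A rooted tree is encoded by its parent map `p` and height `h`, and vertices are compared by the
key (height, vertex). The rank of a parent is the number of neighbours with smaller key. In
breadth-first burning each new vertex has a larger key than all burnt ones, so ranks measured when a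
vertex is adjoined never change: in the final tree every nonsink vertex `x` has parent of rank `b x`
among all its neighbours (`exists_isRootedTree_burningTree`). A parking function never blocks the
fire, so the output spans.

Conversely, a rooted spanning tree is determined once each nonsink vertex is given either its parent
or the rank of its parent, by induction on keys (`parent_eq_of_ncard_eq`). Burning equivalence means
equal parents on `V`, while every hyperedge has rank 0 in a burning tree; so equivalent outputs
coincide, and `c` is read off as the ranks. This is injectivity.

For surjectivity, keep the parents on `V` of a given tree and reattach hyperedges greedily to their
smallest neighbours (`exists_greedy`). The ranks on `V` in this equivalent tree form a parking
function `c`, and uniqueness identifies the tree with `T_c`. -/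

/-! ### Rooted trees as parent and height functions -/

/-- `T` is a tree on the vertex set `S`, rooted at `q`, in which `p x` is the parent of `x` and
`h x` is the height of `x`. -/
structure IsRootedTree {W : Type*} (T : SimpleGraph W) (S : Set W) (q : W) (p : W → W)
    (h : W → ℕ) : Prop where
  root_mem : q ∈ S
  height_root : h q = 0
  parent_mem : ∀ x ∈ S, x ≠ q → p x ∈ S
  height_eq : ∀ x ∈ S, x ≠ q → h x = h (p x) + 1
  adj_iff : ∀ x y, T.Adj x y ↔ (x ∈ S ∧ x ≠ q ∧ p x = y) ∨ (y ∈ S ∧ y ≠ q ∧ p y = x)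

namespace IsRootedTree

variable {W : Type*} {T : SimpleGraph W} {S : Set W} {q : W} {p : W → W} {h : W → ℕ}

lemma adj_parent (hT : IsRootedTree T S q p h) {x : W} (hx : x ∈ S) (hxq : x ≠ q) :
    T.Adj x (p x) :=
  (hT.adj_iff _ _).2 (Or.inl ⟨hx, hxq, rfl⟩)

lemma height_le_of_adj (hT : IsRootedTree T S q p h) {x y : W} (hxy : T.Adj x y) :
    h x ≤ h y + 1 := by
  rcases (hT.adj_iff _ _).1 hxy with ⟨hx, hxq, rfl⟩ | ⟨hy, hyq, rfl⟩
  · rw [hT.height_eq x hx hxq]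
  · rw [hT.height_eq y hy hyq]; omega

lemma exists_walk (hT : IsRootedTree T S q p h) {x : W} (hx : x ∈ S) :
    ∃ w : T.Walk x q, w.length = h x := by
  induction hn : h x generalizing x with
  | zero =>
    obtain rfl : x = q := by
      by_contra hxq
      have := hT.height_eq x hx hxq
      omega
    exact ⟨.nil, rfl⟩
  | succ n ih =>
    have hxq : x ≠ q := by
      rintro rfl
      rw [hT.height_root] at hn
      omega
    obtain ⟨w, hw⟩ := ih (hT.parent_mem x hx hxq) (by have := hT.height_eq x hx hxq; omega)
    exact ⟨.cons (hT.adj_parent hx hxq) w, by simp [hw]⟩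

lemma dist_eq (hT : IsRootedTree T S q p h) {x : W} (hx : x ∈ S) : T.dist x q = h x := by
  obtain ⟨w, hw⟩ := hT.exists_walk hx
  refine le_antisymm (hw ▸ SimpleGraph.dist_le w) ?_
  obtain ⟨w', hw'⟩ := (SimpleGraph.Walk.reachable w).exists_walk_length_eq_dist
  rw [← hw']
  -- Height changes by at most one along an edge, so no walk to the root is shorter than the height.
  have key : ∀ {a b : W} (w : T.Walk a b), h a ≤ h b + w.length := by
    intro a b w
    induction w with
    | nil => simp
    | cons hadj _ ih =>
      have := hT.height_le_of_adj hadj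
      simp only [SimpleGraph.Walk.length_cons]
      omega
  simpa [hT.height_root] using key w'

lemma directedEdge_iff (hT : IsRootedTree T Set.univ q p h) {x y : W} :
    DirectedEdge q T x y ↔ x ≠ q ∧ p x = y := by
  rw [DirectedEdge, hT.adj_iff, hT.dist_eq (Set.mem_univ _), hT.dist_eq (Set.mem_univ _)]
  constructor
  · rintro ⟨⟨-, hxq, hxy⟩ | ⟨-, hyq, rfl⟩, hlt⟩
    · exact ⟨hxq, hxy⟩
    · have := hT.height_eq y trivial hyq
      omega
  · rintro ⟨hxq, rfl⟩
    have := hT.height_eq x trivial hxq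
    exact ⟨Or.inl ⟨trivial, hxq, rfl⟩, by omega⟩

lemma isTree [Finite W] (hT : IsRootedTree T Set.univ q p h) : T.IsTree := by
  have hconn : T.Connected := by
    have : Nonempty W := ⟨q⟩
    refine ⟨fun x y => ?_⟩
    obtain ⟨w, -⟩ := hT.exists_walk (Set.mem_univ x)
    obtain ⟨w', -⟩ := hT.exists_walk (Set.mem_univ y)
    exact w.reachable.trans w'.reachable.symm
  refine SimpleGraph.isTree_iff_connected_and_card.2
    ⟨hconn, le_antisymm ?_ hconn.card_vert_le_card_edgeSet_add_one⟩
  -- Every edge joins a nonroot vertex to its parent, so there are fewer edges than vertices; with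
  -- connectedness this gives a tree.
  have hsub : T.edgeSet ⊆ (fun x => s(x, p x)) '' {x | x ≠ q} := by
    intro e
    induction e with
    | _ x y =>
    intro hxy
    rcases (hT.adj_iff x y).1 hxy with ⟨-, hxq, rfl⟩ | ⟨-, hyq, rfl⟩
    · exact ⟨x, hxq, rfl⟩
    · exact ⟨y, hyq, Sym2.eq_swap⟩
  have h1 : Nat.card T.edgeSet ≤ ({x | x ≠ q} : Set W).ncard :=
    (Set.ncard_le_ncard hsub (Set.toFinite _)).trans (Set.ncard_image_le (Set.toFinite _))
  have h2 : ({x | x ≠ q} : Set W).ncard < Nat.card W := by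
    rw [← Set.ncard_univ]
    exact Set.ncard_lt_ncard (Set.ssubset_univ_iff.2 fun h => by
      have : q ∈ {x | x ≠ q} := h ▸ trivial
      exact this rfl) (Set.toFinite _)
  omega

end IsRootedTree

/-- Every tree is rooted at each of its vertices. -/
lemma SimpleGraph.IsTree.exists_isRootedTree {W : Type*} [Finite W] {T : SimpleGraph W}
    (hT : T.IsTree) (q : W) : ∃ p, IsRootedTree T Set.univ q p (fun x => T.dist x q) := by
  have hp : ∀ x, ∃ y, x ≠ q → T.Adj x y ∧ T.dist x q = T.dist y q + 1 := by
    intro x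
    by_cases hxq : x = q
    · exact ⟨x, fun h => absurd hxq h⟩
    obtain ⟨w, hw⟩ := hT.connected.exists_walk_length_eq_dist x q
    cases w with
    | nil => exact absurd rfl hxq
    | @cons _ y _ hadj w =>
      refine ⟨y, fun _ => ⟨hadj, le_antisymm ?_ ?_⟩⟩
      · obtain ⟨w', hw'⟩ := hT.connected.exists_walk_length_eq_dist y q
        rw [← hw']
        exact SimpleGraph.dist_le (.cons hadj w')
      · rw [← hw, SimpleGraph.Walk.length_cons]
        exact Nat.succ_le_succ (SimpleGraph.dist_le w)
  choose p hp using hp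
  -- Two vertices cannot be each other's parent, since each would be farther from `q` than the
  -- other.
  have hinj : Set.InjOn (fun x => s(x, p x)) {x | x ≠ q} := by
    intro x hx y hy hxy
    rcases Sym2.eq_iff.1 hxy with ⟨h, -⟩ | ⟨h1, h2⟩
    · exact h
    · have := (hp x hx).2
      have := (hp y hy).2
      rw [h2] at *
      rw [← h1] at *
      omega
  have hsub : (fun x => s(x, p x)) '' {x | x ≠ q} ⊆ T.edgeSet := by
    rintro _ ⟨x, hx, rfl⟩
    exact (hp x hx).1
  have hcard := (SimpleGraph.isTree_iff_connected_and_card.1 hT).2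
  -- The parent edges already number one less than the vertices, hence exhaust the tree.
  have himg : (fun x => s(x, p x)) '' {x | x ≠ q} = T.edgeSet := by
    refine Set.eq_of_subset_of_ncard_le hsub ?_ (Set.toFinite _)
    rw [hinj.ncard_image]
    have h1 : ({q} : Set W).ncard + ({q}ᶜ : Set W).ncard = Nat.card W :=
      Set.ncard_add_ncard_compl _ (Set.toFinite _) (Set.toFinite _)
    rw [Set.ncard_singleton] at h1
    have h2 : ({x | x ≠ q} : Set W) = {q}ᶜ := rfl
    rw [h2]
    change Nat.card T.edgeSet ≤ _
    omega
  refine ⟨p, trivial, by simp, fun _ _ _ => trivial, fun x _ hx => (hp x hx).2, fun x y => ?_⟩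
  constructor
  · intro hxy
    have : s(x, y) ∈ (fun x => s(x, p x)) '' {x | x ≠ q} := himg ▸ hxy
    obtain ⟨z, hz, hzxy⟩ := this
    rcases Sym2.eq_iff.1 hzxy with ⟨rfl, h⟩ | ⟨rfl, h⟩
    · exact Or.inl ⟨trivial, hz, h⟩
    · exact Or.inr ⟨trivial, hz, h⟩
  · rintro (⟨-, hx, rfl⟩ | ⟨-, hy, rfl⟩)
    · exact (hp x hx).1
    · exact (hp y hy).1.symm

/-! ### Breadth-first keys and ranks -/

/-- The breadth-first key of `x`: compare heights first, then the vertices themselves. -/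
def heightKey {W : Type*} (h : W → ℕ) (x : W) : ℕ ×ₗ W := toLex (h x, x)

lemma heightKey_injective {W : Type*} (h : W → ℕ) : Function.Injective (heightKey h) :=
  fun _ _ hxy => congrArg (fun z => (ofLex z).2) hxy

lemma heightKey_lt_iff {W : Type*} [LinearOrder W] {h : W → ℕ} {x y : W} :
    heightKey h x < heightKey h y ↔ h x < h y ∨ (h x = h y ∧ x < y) :=
  Prod.Lex.toLex_lt_toLex

lemma heightKey_lt_of_lt {W : Type*} [LinearOrder W] {h : W → ℕ} {x y : W} (hxy : h x < h y) :
    heightKey h x < heightKey h y :=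
  heightKey_lt_iff.2 (Or.inl hxy)

lemma heightKey_congr {W : Type*} {h h' : W → ℕ} {x : W} (hx : h x = h' x) :
    heightKey h x = heightKey h' x := by
  simp [heightKey, hx]

section Rank

variable {W K : Type*} [LinearOrder K] {k : W → K} {A : Set W}

lemma ncard_lower_lt (hA : A.Finite) {i j : W} (hi : i ∈ A) (hij : k i < k j) :
    {a | a ∈ A ∧ k a < k i}.ncard < {a | a ∈ A ∧ k a < k j}.ncard := by
  refine Set.ncard_lt_ncard ⟨fun a ha => ⟨ha.1, ha.2.trans hij⟩, fun h => ?_⟩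
    (hA.subset fun a ha => ha.1)
  exact lt_irrefl _ (h ⟨hi, hij⟩).2

lemma eq_of_ncard_lower_eq (hk : Function.Injective k) (hA : A.Finite) {i j : W} (hi : i ∈ A)
    (hj : j ∈ A) (hij : {a | a ∈ A ∧ k a < k i}.ncard = {a | a ∈ A ∧ k a < k j}.ncard) :
    i = j := by
  rcases lt_trichotomy (k i) (k j) with h | h | h
  · exact absurd hij (ncard_lower_lt hA hi h).ne
  · exact hk h
  · exact absurd hij (ncard_lower_lt hA hj h).ne'

lemma ncard_lower_lt_ncard (hA : A.Finite) {i : W} (hi : i ∈ A) :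
    {a | a ∈ A ∧ k a < k i}.ncard < A.ncard :=
  Set.ncard_lt_ncard ⟨fun _ ha => ha.1, fun h => lt_irrefl _ (h hi).2⟩ hA

/-- Ranks are distinct and below the size of `A`, so by counting every such value occurs. Hence each
ready vertex has a burning edge. -/
lemma exists_ncard_lower_eq (hk : Function.Injective k) (hA : A.Finite) {n : ℕ}
    (hn : n < A.ncard) : ∃ i ∈ A, {a | a ∈ A ∧ k a < k i}.ncard = n := by
  have h : (fun i => {a | a ∈ A ∧ k a < k i}.ncard) '' A = Set.Iio A.ncard := by
    refine Set.eq_of_subset_of_ncard_le ?_ ?_ (Set.finite_Iio _)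
    · rintro _ ⟨i, hi, rfl⟩
      exact ncard_lower_lt_ncard hA hi
    · rw [Set.InjOn.ncard_image fun i hi j hj hij => eq_of_ncard_lower_eq hk hA hi hj hij]
      simp [Set.ncard_eq_toFinset_card']
  have : n ∈ (fun i => {a | a ∈ A ∧ k a < k i}.ncard) '' A := h ▸ hn
  exact this

end Rank

/-- The neighbours of `j` in `S` which are smaller than `i` in the breadth-first order. -/
def lowerNbrs {W : Type*} [LinearOrder W] (G : SimpleGraph W) (S : Set W) (h : W → ℕ) (j i : W) :
    Set W :=
  {a | a ∈ {a | G.Adj j a ∧ a ∈ S} ∧ heightKey h a < heightKey h i}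

/-! ### The invariant of the burning algorithm -/

namespace Burning

variable {W : Type*} {G : SimpleGraph W}

/-- The state of the burning algorithm: `t` is a rooted tree on `S`, the chips of its vertices are
the numbers of smaller edges, and every vertex adjoined later is larger than all of `S`. -/
structure BurnState [LinearOrder W] (q : W) (b : W → ℕ) (S : Set W) (p : W → W) (h : W → ℕ)
    (t : G.Subgraph) : Prop where
  verts_eq : t.verts = S
  tree : IsRootedTree t.spanningCoe S q p h
  card_eq : ∀ x ∈ S, x ≠ q → (lowerNbrs G S h x (p x)).ncard = b x
  lt_later : ∀ j ∉ S, ∀ i ∈ S, G.Adj j i → (lowerNbrs G S h j i).ncard = b j →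
    ∀ x ∈ S, heightKey h x < toLex (h i + 1, j)

lemma adjoin_isRootedTree {β : LinearOrder W} {q : W} {b : W → ℕ} {S A : Set W}
    {p p' : W → W} {h h' : W → ℕ} {t : G.Subgraph} (hT : IsRootedTree t.spanningCoe S q p h)
    (hAS : ∀ x ∈ A, x ∉ S) (hp : ∀ x ∈ S, p' x = p x) (hh : ∀ x ∈ S, h' x = h x)
    (hedge : ∀ x ∈ A, ∀ y, IsBurningEdge q β b t x y ↔ p' x = y) (hpS : ∀ x ∈ A, p' x ∈ S)
    (hhA : ∀ x ∈ A, h' x = h (p' x) + 1) :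
    IsRootedTree (adjoin q β b t A).spanningCoe (S ∪ A) q p' h' where
  root_mem := Or.inl hT.root_mem
  height_root := by rw [hh q hT.root_mem, hT.height_root]
  parent_mem := by
    rintro x (hx | hx) hxq
    · rw [hp x hx]
      exact Or.inl (hT.parent_mem x hx hxq)
    · exact Or.inl (hpS x hx)
  height_eq := by
    rintro x (hx | hx) hxq
    · rw [hp x hx, hh x hx, hh _ (hT.parent_mem x hx hxq), hT.height_eq x hx hxq]
    · rw [hhA x hx, hh _ (hpS x hx)]
  adj_iff := by
    have hq : ∀ x ∈ A, x ≠ q := fun x hx hxq => hAS x hx (hxq ▸ hT.root_mem)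
    have half : ∀ x y, (x ∈ S ∪ A ∧ x ≠ q ∧ p' x = y) ↔
        (x ∈ S ∧ x ≠ q ∧ p x = y) ∨ (x ∈ A ∧ IsBurningEdge q β b t x y) := by
      intro x y
      constructor
      · rintro ⟨hx | hx, hxq, hxy⟩
        · exact Or.inl ⟨hx, hxq, hp x hx ▸ hxy⟩
        · exact Or.inr ⟨hx, (hedge x hx y).2 hxy⟩
      · rintro (⟨hx, hxq, hxy⟩ | ⟨hx, hxy⟩)
        · exact ⟨Or.inl hx, hxq, (hp x hx).trans hxy⟩
        · exact ⟨Or.inr hx, hq x hx, (hedge x hx y).1 hxy⟩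
    intro x y
    rw [half x y, half y x]
    have h1 := hT.adj_iff x y
    have h2 : (adjoin q β b t A).spanningCoe.Adj x y ↔ t.spanningCoe.Adj x y ∨
      (x ∈ A ∧ IsBurningEdge q β b t x y) ∨ (y ∈ A ∧ IsBurningEdge q β b t y x) := Iff.rfl
    rw [h2, h1]
    exact or_or_or_comm

lemma treeLt_iff {β : LinearOrder W} {q : W} {S : Set W} {p : W → W} {h : W → ℕ} {t : G.Subgraph}
    (hT : IsRootedTree t.spanningCoe S q p h) {i j : W} (hi : i ∈ S) (hj : j ∈ S) :
    treeLt q β t i j ↔ heightKey h i < heightKey h j := by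
  rw [treeLt, height, height, hT.dist_eq hi, hT.dist_eq hj]
  exact heightKey_lt_iff.symm

lemma nbrsIn_eq [LinearOrder W] {q : W} {b : W → ℕ} {S : Set W} {p : W → W} {h : W → ℕ}
    {t : G.Subgraph} (hst : BurnState q b S p h t) (j : W) :
    nbrsIn t j = {a | G.Adj j a ∧ a ∈ S} := by
  ext a
  simp [nbrsIn, hst.verts_eq]

lemma isBurningEdge_iff [β : LinearOrder W] {q : W} {b : W → ℕ} {S : Set W} {p : W → W}
    {h : W → ℕ} {t : G.Subgraph} (hst : BurnState q b S p h t) {j i : W} :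
    IsBurningEdge q β b t j i ↔
      (G.Adj j i ∧ i ∈ S) ∧ (lowerNbrs G S h j i).ncard = b j := by
  rw [IsBurningEdge, nbrsIn_eq hst]
  refine and_congr_right fun hi => ?_
  have : {a | a ∈ {a | G.Adj j a ∧ a ∈ S} ∧ treeLt q β t a i} = lowerNbrs G S h j i := by
    ext a
    exact and_congr_right fun ha => treeLt_iff hst.tree ha.2 hi.2
  rw [this]

/-- One step of the burning algorithm adjoins one vertex, as long as some vertex is ready. -/
lemma BurnState.step [Finite W] [β : LinearOrder W] {q : W} {b : W → ℕ} {S : Set W} {p : W → W}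
    {h : W → ℕ} {t : G.Subgraph} (hst : BurnState q b S p h t) (hready : (ready b t).Nonempty) :
    ∃ m ∉ S, ∃ p' h', BurnState q b (insert m S) p' h' (step q β b t) := by
  classical
  have hmem : ∀ j, j ∈ ready b t ↔ j ∉ S ∧ b j < {a | G.Adj j a ∧ a ∈ S}.ncard := by
    intro j
    rw [← nbrsIn_eq hst j, ← hst.verts_eq]
    rfl
  have hex : ∀ j, ∃ i, j ∈ ready b t →
      (G.Adj j i ∧ i ∈ S) ∧ (lowerNbrs G S h j i).ncard = b j := by
    intro j
    by_cases hj : j ∈ ready b t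
    · obtain ⟨i, hi, hi'⟩ := exists_ncard_lower_eq (heightKey_injective h)
        (Set.toFinite _) ((hmem j).1 hj).2
      exact ⟨i, fun _ => ⟨hi, hi'⟩⟩
    · exact ⟨j, fun h => absurd h hj⟩
  choose r hr using hex
  have huniq : ∀ j ∈ ready b t, ∀ i, IsBurningEdge q β b t j i ↔ r j = i := by
    intro j hj i
    rw [isBurningEdge_iff hst]
    constructor
    · rintro ⟨hi, hi'⟩
      exact eq_of_ncard_lower_eq (heightKey_injective h) (Set.toFinite _) (hr j hj).1 hi
        ((hr j hj).2.trans hi'.symm)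
    · rintro rfl
      exact hr j hj
  -- One pair `p'`, `h'` serves both the tree with all ready vertices adjoined, which selects the
  -- next vertex, and the tree with only that vertex. Values at vertices neither burnt nor ready are
  -- junk.
  set p' : W → W := fun x => if x ∈ S then p x else r x with hp'
  set h' : W → ℕ := fun x => if x ∈ S then h x else h (r x) + 1 with hh'
  have hpS : ∀ x ∈ S, p' x = p x := fun x hx => if_pos hx
  have hhS : ∀ x ∈ S, h' x = h x := fun x hx => if_pos hx
  have hpn : ∀ x ∉ S, p' x = r x := fun x hx => if_neg hx
  have hhn : ∀ x ∉ S, h' x = h (r x) + 1 := fun x hx => if_neg hx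
  have hkS : ∀ x ∈ S, heightKey h' x = heightKey h x := fun x hx => heightKey_congr (hhS x hx)
  have hnot : ∀ x ∈ ready b t, x ∉ S := fun x hx => ((hmem x).1 hx).1
  have hsub : ∀ A ⊆ ready b t, IsRootedTree (adjoin q β b t A).spanningCoe (S ∪ A) q p' h' := by
    intro A hA
    refine adjoin_isRootedTree hst.tree (fun x hx => hnot x (hA hx)) hpS hhS ?_ ?_ ?_
    · intro x hx y
      rw [hpn x (hnot x (hA hx))]
      exact huniq x (hA hx) y
    · intro x hx
      rw [hpn x (hnot x (hA hx))]
      exact (hr x (hA hx)).1.2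
    · intro x hx
      rw [hpn x (hnot x (hA hx)), hhn x (hnot x (hA hx))]
  obtain ⟨m, hm, hmin⟩ :=
    Set.exists_min_image (ready b t) (heightKey h') (Set.toFinite _) hready
  have hmS := hnot m hm
  have hlt : ∀ x ∈ S, heightKey h' x < heightKey h' m := by
    intro x hx
    rw [hkS x hx]
    have := hst.lt_later m hmS (r m) (hr m hm).1.2 (hr m hm).1.1 (hr m hm).2 x hx
    rwa [← hhn m hmS] at this
  have hnext : nextVertex q β b t = {m} := by
    ext x
    have hall := hsub _ subset_rfl
    constructor
    · rintro ⟨hx, hx'⟩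
      have h1 := hx' m hm
      rw [treeLt_iff hall (Or.inr hm) (Or.inr hx), not_lt] at h1
      exact heightKey_injective h' (le_antisymm h1 (hmin x hx))
    · rintro rfl
      refine ⟨hm, fun j hj => ?_⟩
      rw [treeLt_iff hall (Or.inr hj) (Or.inr hm), not_lt]
      exact hmin j hj
  have hins : S ∪ {m} = insert m S := Set.union_singleton
  -- As `m` lies above all of `S`, its arrival changes no rank.
  have hlow : ∀ x, ∀ i ∈ S, lowerNbrs G (insert m S) h' x i = lowerNbrs G S h x i := by
    intro x i hi
    ext a
    constructor
    · rintro ⟨⟨ha, rfl | haS⟩, hai⟩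
      · exact absurd hai (hlt i hi).not_gt
      · exact ⟨⟨ha, haS⟩, by rwa [hkS a haS, hkS i hi] at hai⟩
    · rintro ⟨⟨ha, haS⟩, hai⟩
      exact ⟨⟨ha, Or.inr haS⟩, by rwa [hkS a haS, hkS i hi]⟩
  refine ⟨m, hmS, p', h', ?_⟩
  rw [Burning.step, hnext]
  refine ⟨?_, ?_, ?_, ?_⟩
  · rw [← hins, ← hst.verts_eq]
    rfl
  · rw [← hins]
    exact hsub {m} (Set.singleton_subset_iff.2 hm)
  · rintro x (rfl | hx) hxq
    · rw [hpn x hmS, hlow _ _ (hr x hm).1.2]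
      exact (hr x hm).2
    · rw [hpS x hx, hlow _ _ (hst.tree.parent_mem x hx hxq)]
      exact hst.card_eq x hx hxq
  · intro j hj i hi hji hcard
    have hjm : j ≠ m := fun h => hj (Or.inl h)
    have hjS : j ∉ S := fun h => hj (Or.inr h)
    -- If `j` would attach to the new vertex, it is higher than it, hence above everything.
    -- Otherwise `j` was already ready with the same burning edge, and the minimal choice of `m`
    -- puts `m` below it.
    rcases hi with rfl | hi
    · have h1 : heightKey h' i < toLex (h' i + 1, j) :=
        Prod.Lex.toLex_lt_toLex.2 (Or.inl (Nat.lt_succ_self _))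
      rintro x (rfl | hx)
      · exact h1
      · exact (hlt x hx).trans h1
    · rw [hlow j i hi] at hcard
      rw [hhS i hi]
      have hjr : j ∈ ready b t :=
        (hmem j).2 ⟨hjS, hcard ▸ ncard_lower_lt_ncard (k := heightKey h) (Set.toFinite _)
          (show i ∈ {a | G.Adj j a ∧ a ∈ S} from ⟨hji, hi⟩)⟩
      have hri : r j = i := (huniq j hjr i).1 ((isBurningEdge_iff hst).2 ⟨⟨hji, hi⟩, hcard⟩)
      rintro x (rfl | hx)
      · have h1 : heightKey h' x < heightKey h' j :=
          lt_of_le_of_ne (hmin j hjr) fun h => hjm (heightKey_injective h' h).symm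
        rwa [heightKey, heightKey, hhn j hjS, hri] at h1
      · rw [hkS x hx]
        exact hst.lt_later j hjS i hi hji hcard x hx

lemma burnState_singleton [LinearOrder W] (q : W) (b : W → ℕ) :
    BurnState q b {q} id (fun _ => 0) (G.singletonSubgraph q) where
  verts_eq := rfl
  tree :=
    { root_mem := rfl
      height_root := rfl
      parent_mem := fun _ hx _ => hx
      height_eq := fun _ hx hxq => absurd hx hxq
      adj_iff := fun x y => by
        constructor
        · intro h
          exact absurd h (by simp)
        · rintro (⟨hx, hxq, -⟩ | ⟨hx, hxq, -⟩) <;> exact absurd hx hxq }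
  card_eq := fun _ hx hxq => absurd hx hxq
  lt_later := by
    rintro j - i - - - x -
    exact Prod.Lex.toLex_lt_toLex.2 (Or.inl (Nat.succ_pos _))

/-- If no proper set of vertices containing the sink blocks the fire, then the burning algorithm
produces a rooted spanning tree in which the chips of each vertex are the number of its edges
smaller than the one to its parent. -/
theorem exists_isRootedTree_burningTree [Finite W] [β : LinearOrder W] {q : W} {b : W → ℕ}
    (hb : ∀ S : Set W, q ∈ S → S ≠ Set.univ → ∃ j ∉ S, b j < {a | G.Adj j a ∧ a ∈ S}.ncard) :
    burningTree G q β b ≤ G ∧ ∃ p h, IsRootedTree (burningTree G q β b) Set.univ q p h ∧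
      ∀ x, x ≠ q → (lowerNbrs G Set.univ h x (p x)).ncard = b x := by
  have key : ∀ n, n + 1 ≤ Nat.card W → ∃ S p h, S.ncard = n + 1 ∧
      BurnState q b S p h ((step q β b)^[n] (G.singletonSubgraph q)) := by
    intro n
    induction n with
    | zero => exact fun _ => ⟨{q}, id, fun _ => 0, by simp, burnState_singleton q b⟩
    | succ n ih =>
      intro hn
      obtain ⟨S, p, h, hS, hst⟩ := ih (by omega)
      obtain ⟨j, hj, hj'⟩ := hb S hst.tree.root_mem fun h => by
        rw [h, Set.ncard_univ] at hS
        omega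
      obtain ⟨m, hm, p', h', hst'⟩ := hst.step
        ⟨j, by rwa [hst.verts_eq], by rw [nbrsIn_eq hst]; exact hj'⟩
      refine ⟨insert m S, p', h', ?_, ?_⟩
      · rw [Set.ncard_insert_of_notMem hm (Set.toFinite _), hS]
      · rw [Function.iterate_succ_apply']
        exact hst'
  have : Nonempty W := ⟨q⟩
  have hpos : 0 < Nat.card W := Nat.card_pos
  obtain ⟨S, p, h, hS, hst⟩ := key (Nat.card W - 1) (by omega)
  obtain rfl : S = Set.univ :=
    Set.eq_of_subset_of_ncard_le (Set.subset_univ S) (by rw [Set.ncard_univ]; omega)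
      (Set.toFinite _)
  exact ⟨fun _ _ hxy => SimpleGraph.Subgraph.adj_sub _ hxy, p, h, hst.tree,
    fun x hx => hst.card_eq x trivial hx⟩

end Burning

/-! ### Uniqueness from ranks, and greedy reattachment -/

namespace IsRootedTree

variable {W : Type*} {G T T' : SimpleGraph W} {q : W} {p p' : W → W} {h h' : W → ℕ}

lemma heightKey_parent_lt [LinearOrder W] (hT : IsRootedTree T Set.univ q p h) {x : W}
    (hx : x ≠ q) : heightKey h (p x) < heightKey h x :=
  heightKey_lt_of_lt (by rw [hT.height_eq x trivial hx]; exact Nat.lt_succ_self _)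

/-- If two rooted trees agree below the key of `x` and the parents of `x` have the same rank, then
they agree at `x`. -/
lemma parent_eq_of_agree_below [Finite W] [LinearOrder W] (hT : IsRootedTree T Set.univ q p h)
    (hT' : IsRootedTree T' Set.univ q p' h') (hTG : T ≤ G) (hTG' : T' ≤ G) {x : W} (hx : x ≠ q)
    (hlow : ∀ y, heightKey h y < heightKey h x → h y = h' y)
    (hlow' : ∀ y, heightKey h' y < heightKey h x → h y = h' y)
    (hcard : p x = p' x ∨
      (lowerNbrs G Set.univ h x (p x)).ncard = (lowerNbrs G Set.univ h' x (p' x)).ncard) :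
    p x = p' x ∧ h x = h' x := by
  have hpx := hT.heightKey_parent_lt hx
  have hkp := heightKey_congr (hlow _ hpx)
  have hp : p x = p' x := by
    rcases hcard with hp | hcard
    · exact hp
    -- Only keys below that of `p x` matter here, and there the two height functions agree.
    have hset : lowerNbrs G Set.univ h x (p x) = lowerNbrs G Set.univ h' x (p x) := by
      ext a
      refine and_congr_right fun _ => ⟨fun ha => ?_, fun ha => ?_⟩
      · rwa [← heightKey_congr (hlow a (ha.trans hpx)), ← hkp]
      · rw [← hkp] at ha
        rwa [heightKey_congr (hlow' a (ha.trans hpx))]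
    rw [hset] at hcard
    exact eq_of_ncard_lower_eq (A := {a | G.Adj x a ∧ a ∈ Set.univ}) (heightKey_injective h')
      (Set.toFinite _)
      ⟨hTG (hT.adj_parent trivial hx), trivial⟩ ⟨hTG' (hT'.adj_parent trivial hx), trivial⟩ hcard
  refine ⟨hp, ?_⟩
  rw [hT.height_eq x trivial hx, hT'.height_eq x trivial hx, ← hp, hlow _ hpx]

/-- A rooted spanning tree is determined by giving, for each vertex, its parent or the rank of its
parent among its neighbours in the breadth-first order. -/
theorem parent_eq_of_ncard_eq [Finite W] [LinearOrder W] (hT : IsRootedTree T Set.univ q p h)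
    (hT' : IsRootedTree T' Set.univ q p' h') (hTG : T ≤ G) (hTG' : T' ≤ G)
    (hcard : ∀ x, x ≠ q → p x = p' x ∨
      (lowerNbrs G Set.univ h x (p x)).ncard = (lowerNbrs G Set.univ h' x (p' x)).ncard) :
    h = h' ∧ ∀ x, x ≠ q → p x = p' x := by
  set D : Set W := {x | x ≠ q ∧ ¬(p x = p' x ∧ h x = h' x)} with hD
  have hgood : ∀ y, y ∉ D → h y = h' y := by
    intro y hy
    by_cases hyq : y = q
    · rw [hyq, hT.height_root, hT'.height_root]
    · by_contra hne
      exact hy ⟨hyq, fun h => hne h.2⟩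
  have hempty : D = ∅ := by
    by_contra hne
    have hne := Set.nonempty_iff_ne_empty.2 hne
    obtain ⟨x, hx, hmin⟩ := Set.exists_min_image D (heightKey h) (Set.toFinite _) hne
    obtain ⟨x', hx', hmin'⟩ := Set.exists_min_image D (heightKey h') (Set.toFinite _) hne
    have hlow : ∀ y, heightKey h y < heightKey h x → h y = h' y :=
      fun y hy => hgood y fun hyD => (hmin y hyD).not_gt hy
    have hlow' : ∀ y, heightKey h' y < heightKey h' x' → h y = h' y :=
      fun y hy => hgood y fun hyD => (hmin' y hyD).not_gt hy
    -- Below the smaller of the two minimal keys of disagreement, both keyings see only agreeing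
    -- vertices, so the vertex there agrees as well.
    rcases le_total (heightKey h x) (heightKey h' x') with hle | hle
    · exact hx.2 (hT.parent_eq_of_agree_below hT' hTG hTG' hx.1 hlow
        (fun y hy => hlow' y (hy.trans_le hle)) (hcard x hx.1))
    · have := hT'.parent_eq_of_agree_below hT hTG' hTG hx'.1 (fun y hy => (hlow' y hy).symm)
        (fun y hy => (hlow y (hy.trans_le hle)).symm)
        ((hcard x' hx'.1).imp Eq.symm Eq.symm)
      exact hx'.2 ⟨this.1.symm, this.2.symm⟩
  have hall : ∀ y, y ∉ D := fun y hy => by rw [hempty] at hy; exact hy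
  refine ⟨funext fun y => hgood y (hall y), fun x hx => ?_⟩
  by_contra hne
  exact hall x ⟨hx, fun h => hne h.1⟩

/-- Given a rooted spanning tree and a set `A` of vertices, there is a rooted spanning tree with the
same parents outside `A`, in which the parent of each vertex of `A` is its smallest neighbour. -/
theorem exists_greedy [Finite W] [LinearOrder W] (hT : IsRootedTree T Set.univ q p h)
    (hTG : T ≤ G) {A : Set W} (hqA : q ∉ A) :
    ∃ (T' : SimpleGraph W) (p' : W → W) (h' : W → ℕ), IsRootedTree T' Set.univ q p' h' ∧
      T' ≤ G ∧ (∀ x, x ∉ A → p' x = p x) ∧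
      ∀ x ∈ A, lowerNbrs G Set.univ h' x (p' x) = ∅ := by
  classical
  have hne : ∀ x ∈ A, x ≠ q := fun x hx hxq => hqA (hxq ▸ hx)
  -- `R n x`: some walk of `n` moves leads from `x` to `q`, where a vertex of `A` may move to any
  -- neighbour and any other vertex must move to its parent. The new height `d` is the least such
  -- `n`; paths of `T` show that one exists.
  let R : ℕ → W → Prop := fun n => Nat.rec (motive := fun _ => W → Prop) (fun x => x = q)
    (fun _ P x => ∃ y, (x ≠ q ∧ ((x ∈ A ∧ G.Adj x y) ∨ (x ∉ A ∧ p x = y))) ∧ P y) n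
  have hR : ∀ n x, h x = n → R n x := by
    intro n
    induction n with
    | zero =>
      intro x hx
      by_contra hxq
      have := hT.height_eq x trivial hxq
      omega
    | succ n ih =>
      intro x hx
      have hxq : x ≠ q := by
        rintro rfl
        rw [hT.height_root] at hx
        omega
      refine ⟨p x, ⟨hxq, ?_⟩, ih _ (by have := hT.height_eq x trivial hxq; omega)⟩
      by_cases hxA : x ∈ A
      · exact Or.inl ⟨hxA, hTG (hT.adj_parent trivial hxq)⟩
      · exact Or.inr ⟨hxA, rfl⟩
  have hex : ∀ x, ∃ n, R n x := fun x => ⟨h x, hR _ x rfl⟩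
  set d : W → ℕ := fun x => Nat.find (p := fun n => R n x) (hex x) with hd
  have hdR : ∀ x, R (d x) x := fun x => Nat.find_spec (hex x)
  have hdle : ∀ n x, R n x → d x ≤ n := fun n x hx => Nat.find_min' (hex x) hx
  have hdq : d q = 0 := Nat.le_zero.1 (hdle 0 q rfl)
  have hdpos : ∀ x, x ≠ q → ∃ n, d x = n + 1 := by
    intro x hx
    refine Nat.exists_eq_succ_of_ne_zero fun h0 => hx ?_
    have := hdR x
    rwa [h0] at this
  have hmin : ∀ x, ∃ y, x ∈ A → G.Adj x y ∧ ∀ z, G.Adj x z → heightKey d y ≤ heightKey d z := by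
    intro x
    by_cases hx : x ∈ A
    · obtain ⟨y, hy, hy'⟩ := Set.exists_min_image {y | G.Adj x y} (heightKey d) (Set.toFinite _)
        ⟨p x, hTG (hT.adj_parent trivial (hne x hx))⟩
      exact ⟨y, fun _ => ⟨hy, hy'⟩⟩
    · exact ⟨x, fun h => absurd h hx⟩
  choose g hg using hmin
  set p' : W → W := fun x => if x ∈ A then g x else p x with hp'
  have hpA : ∀ x ∈ A, p' x = g x := fun x hx => if_pos hx
  have hpn : ∀ x, x ∉ A → p' x = p x := fun x hx => if_neg hx
  -- The move to `p' x` starts a shortest walk: it is forced outside `A`, and in `A` a neighbour of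
  -- least key also has least `d`.
  have hheight : ∀ x, x ≠ q → d x = d (p' x) + 1 := by
    intro x hx
    obtain ⟨n, hn⟩ := hdpos x hx
    have hRx := hdR x
    rw [hn] at hRx
    obtain ⟨y, ⟨-, hxy⟩, hy⟩ := hRx
    have hyn := hdle n y hy
    rcases hxy with ⟨hxA, hxy⟩ | ⟨hxA, rfl⟩
    · rw [hpA x hxA]
      refine le_antisymm (hdle _ _ ⟨g x, ⟨hx, Or.inl ⟨hxA, (hg x hxA).1⟩⟩, hdR _⟩) ?_
      have h1 : d (g x) ≤ d y := by
        by_contra hlt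
        exact ((hg x hxA).2 y hxy).not_gt (heightKey_lt_of_lt (not_le.1 hlt))
      omega
    · rw [hpn x hxA]
      refine le_antisymm (hdle _ _ ⟨p x, ⟨hx, Or.inr ⟨hxA, rfl⟩⟩, hdR _⟩) ?_
      omega
  have hadj : ∀ x, x ≠ q → G.Adj x (p' x) := by
    intro x hx
    by_cases hxA : x ∈ A
    · rw [hpA x hxA]
      exact (hg x hxA).1
    · rw [hpn x hxA]
      exact hTG (hT.adj_parent trivial hx)
  let T' : SimpleGraph W :=
    { Adj := fun x y => (x ∈ Set.univ ∧ x ≠ q ∧ p' x = y) ∨ (y ∈ Set.univ ∧ y ≠ q ∧ p' y = x)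
      symm := ⟨fun _ _ => Or.symm⟩
      loopless := ⟨fun x hx => by
        rcases hx with ⟨-, hx, hxx⟩ | ⟨-, hx, hxx⟩ <;>
        · have := hheight x hx
          rw [hxx] at this
          omega⟩ }
  refine ⟨T', p', d, ⟨trivial, hdq, fun _ _ _ => trivial, fun x _ => hheight x,
    fun _ _ => Iff.rfl⟩, ?_, hpn, ?_⟩
  · rintro x y (⟨-, hx, rfl⟩ | ⟨-, hy, rfl⟩)
    · exact hadj x hx
    · exact (hadj y hy).symm
  · intro x hx
    refine Set.eq_empty_of_forall_notMem fun a ha => ?_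
    have := ha.2
    rw [hpA x hx] at this
    exact ((hg x hx).2 a ha.1.1).not_gt this

end IsRootedTree

/-! ### Parking functions and the incidence graph -/

namespace Hypergraph

variable {α : Type*} {H : Hypergraph α} {q : H.vertexSet}

lemma edgeSet_finite (hfin : H.vertexSet.Finite) : H.edgeSet.Finite :=
  hfin.powerset.subset edgeSet_subset_powerset_vertexSet

lemma exists_inl_of_adj_inr {v : H.vertexSet} {x : H.edgeSet ⊕ H.vertexSet}
    (hx : H.incidenceGraph.Adj (Sum.inr v) x) : ∃ e : H.edgeSet, x = Sum.inl e ∧ v.1 ∈ e.1 := by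
  rcases x with e | w
  · exact ⟨e, rfl, hx⟩
  · exact hx.elim

lemma exists_inr_of_adj_inl {e : H.edgeSet} {x : H.edgeSet ⊕ H.vertexSet}
    (hx : H.incidenceGraph.Adj (Sum.inl e) x) : ∃ v : H.vertexSet, x = Sum.inr v ∧ v.1 ∈ e.1 := by
  rcases x with f | v
  · exact hx.elim
  · exact ⟨v, rfl, hx⟩

/-- The underlying set of a hyperedge. -/
def edgeOf : H.edgeSet ⊕ H.vertexSet → Set α :=
  Sum.elim Subtype.val fun _ => ∅

/-- A parking function does not block the fire in the incidence graph. -/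
lemma IsParkingFunction.exists_burning (hfin : H.vertexSet.Finite) (hne : ∅ ∉ H.edgeSet)
    {c : {v : H.vertexSet // v ≠ q} → ℕ} (hc : H.IsParkingFunction q c)
    {S : Set (H.edgeSet ⊕ H.vertexSet)} (hq : Sum.inr q ∈ S) (hS : S ≠ Set.univ) :
    ∃ j ∉ S, H.liftConfig q c j < {a | H.incidenceGraph.Adj j a ∧ a ∈ S}.ncard := by
  have : Finite H.vertexSet := hfin
  have : Finite H.edgeSet := edgeSet_finite hfin
  -- An unburnt hyperedge meeting the fire has no chips and is ready. If there is none, the parking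
  -- condition is applied to the set of unburnt vertices: a hyperedge not contained in it has a
  -- burnt vertex, so is itself burnt.
  by_cases hedge : ∃ (e : H.edgeSet) (v : H.vertexSet), Sum.inl e ∉ S ∧ Sum.inr v ∈ S ∧ v.1 ∈ e.1
  · obtain ⟨e, v, he, hv, hve⟩ := hedge
    refine ⟨Sum.inl e, he, ?_⟩
    rw [liftConfig, Set.ncard_pos (Set.toFinite _)]
    exact ⟨Sum.inr v, hve, hv⟩
  have hedge' : ∀ (e : H.edgeSet) (v : H.vertexSet), Sum.inr v ∈ S → v.1 ∈ e.1 → Sum.inl e ∈ S :=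
    fun e v hv hve => by_contra fun he => hedge ⟨e, v, he, hv, hve⟩
  have hTne : {v : {v : H.vertexSet // v ≠ q} | Sum.inr v.1 ∉ S}.Nonempty := by
    have hmk : ∀ v : H.vertexSet, Sum.inr v ∉ S →
        {v : {v : H.vertexSet // v ≠ q} | Sum.inr v.1 ∉ S}.Nonempty :=
      fun v hv => ⟨⟨v, fun h => hv (h ▸ hq)⟩, hv⟩
    obtain ⟨x, hx⟩ := (Set.ne_univ_iff_exists_notMem S).1 hS
    rcases x with e | v
    · obtain ⟨v, hv⟩ : (e.1 : Set α).Nonempty :=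
        Set.nonempty_iff_ne_empty.2 fun h => hne (h ▸ e.2)
      exact hmk ⟨v, mem_vertexSet_of_mem_edgeSet e.2 hv⟩ fun h => hx (hedge' e _ h hv)
    · exact hmk v hx
  obtain ⟨i, hi, hci⟩ := hc _ hTne
  refine ⟨Sum.inr i.1, hi, ?_⟩
  have hlift : H.liftConfig q c (Sum.inr i.1) = c i := by
    rw [liftConfig, dif_pos i.2]
  rw [hlift]
  refine hci.trans_le ?_
  refine le_trans (Set.ncard_le_ncard (t := edgeOf '' {a | H.incidenceGraph.Adj (Sum.inr i.1) a ∧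
    a ∈ S}) ?_ (Set.toFinite _)) (Set.ncard_image_le (Set.toFinite _))
  rintro e ⟨he, hie, hsub⟩
  obtain ⟨u, hu, hu'⟩ := Set.not_subset.1 hsub
  refine ⟨Sum.inl ⟨e, he⟩, ⟨hie, ?_⟩, rfl⟩
  refine hedge' _ ⟨u, mem_vertexSet_of_mem_edgeSet he hu⟩ (by_contra fun huS => hu' ?_) hu
  exact ⟨_, ⟨⟨⟨u, mem_vertexSet_of_mem_edgeSet he hu⟩, fun h => huS (h ▸ hq)⟩, huS, rfl⟩, rfl⟩

/-- The ranks of the parents of the nonsink vertices of a rooted spanning tree of the incidence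
graph form a parking function. -/
lemma isParkingFunction_ncard_lowerNbrs [LinearOrder (H.edgeSet ⊕ H.vertexSet)]
    (hfin : H.vertexSet.Finite) {T : SimpleGraph (H.edgeSet ⊕ H.vertexSet)}
    {p : H.edgeSet ⊕ H.vertexSet → H.edgeSet ⊕ H.vertexSet} {h : H.edgeSet ⊕ H.vertexSet → ℕ}
    (hT : IsRootedTree T Set.univ (Sum.inr q) p h) (hTG : T ≤ H.incidenceGraph) :
    H.IsParkingFunction q fun v =>
      (lowerNbrs H.incidenceGraph Set.univ h (Sum.inr v.1) (p (Sum.inr v.1))).ncard := by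
  have : Finite H.vertexSet := hfin
  have : Finite H.edgeSet := edgeSet_finite hfin
  intro S hS
  -- For `i` of least key in `S`, the parent of `i` and the lower neighbours are rank + 1 hyperedges
  -- with key below `i`. The parent of each has a still smaller key, so lies outside `S`; all of
  -- them count in the relative degree.
  obtain ⟨i, hi, hmin⟩ := Set.exists_min_image S (fun v => heightKey h (Sum.inr v.1))
    (Set.toFinite _) hS
  refine ⟨i, hi, ?_⟩
  have hiq : (Sum.inr i.1 : H.edgeSet ⊕ H.vertexSet) ≠ Sum.inr q :=
    fun h => i.2 (Sum.inr_injective h)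
  set A := lowerNbrs H.incidenceGraph Set.univ h (Sum.inr i.1) (p (Sum.inr i.1)) with hA
  have hnot : p (Sum.inr i.1) ∉ A := fun h => lt_irrefl _ h.2
  have hcard : (insert (p (Sum.inr i.1)) A).ncard = A.ncard + 1 :=
    Set.ncard_insert_of_notMem hnot (Set.toFinite _)
  have hmem : ∀ x ∈ insert (p (Sum.inr i.1)) A, H.incidenceGraph.Adj (Sum.inr i.1) x ∧
      heightKey h x < heightKey h (Sum.inr i.1) := by
    rintro x (rfl | hx)
    · exact ⟨hTG (hT.adj_parent trivial hiq), hT.heightKey_parent_lt hiq⟩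
    · exact ⟨hx.1.1, hx.2.trans (hT.heightKey_parent_lt hiq)⟩
  refine Nat.lt_of_succ_le ?_
  rw [Nat.succ_eq_add_one, ← hcard]
  refine Set.ncard_le_ncard_of_injOn edgeOf ?_ ?_
    ((edgeSet_finite hfin).subset fun e he => he.1)
  · intro x hx
    obtain ⟨hadj, hlt⟩ := hmem x hx
    obtain ⟨e, rfl, hie⟩ := exists_inl_of_adj_inr hadj
    have heq : (Sum.inl e : H.edgeSet ⊕ H.vertexSet) ≠ Sum.inr q := Sum.inl_ne_inr
    obtain ⟨u, hu, hue⟩ := exists_inr_of_adj_inl (hTG (hT.adj_parent trivial heq))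
    refine ⟨e.2, hie, fun hsub => ?_⟩
    obtain ⟨_, ⟨w, hw, rfl⟩, hwu⟩ := hsub hue
    have h1 := hT.heightKey_parent_lt heq
    rw [hu, ← Subtype.ext hwu] at h1
    exact (hmin w hw).not_gt (h1.trans hlt)
  · intro x hx y hy hxy
    obtain ⟨e, rfl, -⟩ := exists_inl_of_adj_inr (hmem x hx).1
    obtain ⟨f, rfl, -⟩ := exists_inl_of_adj_inr (hmem y hy).1
    exact congrArg Sum.inl (Subtype.ext hxy)

/-- Rooted spanning trees of the incidence graph are burning equivalent if and only if each nonsink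
vertex has the same parent in both. -/
lemma rightToLeft_eq_iff {T T' : SimpleGraph (H.edgeSet ⊕ H.vertexSet)}
    {p p' : H.edgeSet ⊕ H.vertexSet → H.edgeSet ⊕ H.vertexSet}
    {h h' : H.edgeSet ⊕ H.vertexSet → ℕ} (hT : IsRootedTree T Set.univ (Sum.inr q) p h)
    (hT' : IsRootedTree T' Set.univ (Sum.inr q) p' h') (hTG : T ≤ H.incidenceGraph) :
    rightToLeft q T = rightToLeft q T' ↔ ∀ v, v ≠ q → p (Sum.inr v) = p' (Sum.inr v) := by
  have hmem : ∀ v e, (v, e) ∈ rightToLeft q T ↔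
      (Sum.inr v : H.edgeSet ⊕ H.vertexSet) ≠ Sum.inr q ∧ p (Sum.inr v) = Sum.inl e :=
    fun v e => hT.directedEdge_iff
  have hmem' : ∀ v e, (v, e) ∈ rightToLeft q T' ↔
      (Sum.inr v : H.edgeSet ⊕ H.vertexSet) ≠ Sum.inr q ∧ p' (Sum.inr v) = Sum.inl e :=
    fun v e => hT'.directedEdge_iff
  constructor
  · intro heq v hv
    have hvq : (Sum.inr v : H.edgeSet ⊕ H.vertexSet) ≠ Sum.inr q :=
      fun h => hv (Sum.inr_injective h)
    obtain ⟨e, he, -⟩ := exists_inl_of_adj_inr (hTG (hT.adj_parent trivial hvq))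
    have h1 := (hmem v e).2 ⟨hvq, he⟩
    rw [heq, hmem'] at h1
    rw [he, h1.2]
  · intro heq
    ext ⟨v, e⟩
    rw [hmem, hmem']
    refine and_congr_right fun hvq => ?_
    rw [heq v fun h => hvq (congrArg _ h)]

end Hypergraph

/-! ### The bijection -/

theorem theorem4p6 {α : Type*} (H : Hypergraph α) (hfin : H.vertexSet.Finite)
    (hne : ∅ ∉ H.edgeSet) (hconn : H.IsConnected) (q : H.vertexSet)
    (β : LinearOrder (H.edgeSet ⊕ H.vertexSet)) :
    ∃ hT : ∀ c : {c : {v : H.vertexSet // v ≠ q} → ℕ // H.IsParkingFunction q c},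
        IsSpanningTree H.incidenceGraph (H.burningTree q β c.1),
      Function.Bijective
        (fun c : {c : {v : H.vertexSet // v ≠ q} → ℕ // H.IsParkingFunction q c} =>
          Hypergraph.RootedSpanningTree.mk H q ⟨H.burningTree q β c.1, hT c⟩) := by
  have : Finite H.vertexSet := hfin
  have : Finite H.edgeSet := Hypergraph.edgeSet_finite hfin
  have hburn : ∀ c : {c : {v : H.vertexSet // v ≠ q} → ℕ // H.IsParkingFunction q c},
      H.burningTree q β c.1 ≤ H.incidenceGraph ∧
      ∃ p h, IsRootedTree (H.burningTree q β c.1) Set.univ (Sum.inr q) p h ∧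
        ∀ x, x ≠ Sum.inr q →
          (lowerNbrs H.incidenceGraph Set.univ h x (p x)).ncard = H.liftConfig q c.1 x :=
    fun c => Burning.exists_isRootedTree_burningTree
      fun S hq hS => c.2.exists_burning hfin hne hq hS
  have hlift : ∀ (c : {v : H.vertexSet // v ≠ q} → ℕ) (v : {v : H.vertexSet // v ≠ q}),
      H.liftConfig q c (Sum.inr v.1) = c v := by
    intro c v
    rw [Hypergraph.liftConfig, dif_pos v.2]
  have hspan : ∀ c : {c : {v : H.vertexSet // v ≠ q} → ℕ // H.IsParkingFunction q c},
      IsSpanningTree H.incidenceGraph (H.burningTree q β c.1) := by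
    intro c
    obtain ⟨hle, p, h, hT, -⟩ := hburn c
    exact ⟨hle, hT.isTree⟩
  refine ⟨hspan, ?_, ?_⟩
  · intro c c' hcc
    have hequiv : rightToLeft q (H.burningTree q β c.1) = rightToLeft q (H.burningTree q β c'.1) :=
      Quotient.exact hcc
    obtain ⟨hle, p, h, hT, hcard⟩ := hburn c
    obtain ⟨hle', p', h', hT', hcard'⟩ := hburn c'
    have hpar := (Hypergraph.rightToLeft_eq_iff hT hT' hle).1 hequiv
    -- Hyperedges agree by rank, both being 0; vertices agree by parent, from burning equivalence.
    obtain ⟨hh, hp⟩ := hT.parent_eq_of_ncard_eq hT' hle hle' (by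
      rintro (e | v) hx
      · exact Or.inr ((hcard _ hx).trans (hcard' _ hx).symm)
      · exact Or.inl (hpar v fun h => hx (congrArg _ h)))
    refine Subtype.ext (funext fun v => ?_)
    have hv : (Sum.inr v.1 : H.edgeSet ⊕ H.vertexSet) ≠ Sum.inr q :=
      fun h => v.2 (Sum.inr_injective h)
    rw [← hlift c.1 v, ← hlift c'.1 v, ← hcard _ hv, ← hcard' _ hv, hh, hp _ hv]
  · intro t
    induction t using Quotient.inductionOn with
    | h T =>
    obtain ⟨T, hTG, hTree⟩ := T
    obtain ⟨p, hT⟩ := hTree.exists_isRootedTree (Sum.inr q)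
    obtain ⟨T', p', h', hT', hTG', hpar, hmin⟩ := hT.exists_greedy hTG
      (A := Set.range Sum.inl) (by rintro ⟨e, he⟩; exact Sum.inl_ne_inr he)
    refine ⟨⟨_, Hypergraph.isParkingFunction_ncard_lowerNbrs hfin hT' hTG'⟩, Quotient.sound ?_⟩
    set c : {c : {v : H.vertexSet // v ≠ q} → ℕ // H.IsParkingFunction q c} :=
      ⟨_, Hypergraph.isParkingFunction_ncard_lowerNbrs hfin hT' hTG'⟩ with hc
    obtain ⟨hle, p'', h'', hT'', hcard⟩ := hburn c
    -- Here all vertices are compared by rank: 0 on hyperedges by greediness, `c` on `V` by its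
    -- definition.
    obtain ⟨-, hp⟩ := hT''.parent_eq_of_ncard_eq hT' hle hTG' (by
      rintro (e | v) hx
      · refine Or.inr ((hcard _ hx).trans ?_)
        rw [hmin _ ⟨e, rfl⟩, Set.ncard_empty, Hypergraph.liftConfig]
      · exact Or.inr ((hcard _ hx).trans (hlift c.1 ⟨v, fun h => hx (congrArg _ h)⟩)))
    refine (Hypergraph.rightToLeft_eq_iff hT'' hT hle).2 fun v hv => ?_
    rw [hp _ fun h => hv (Sum.inr_injective h), hpar _ (by rintro ⟨e, he⟩; exact Sum.inl_ne_inr he)]
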